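/- For integers $r\ge 1$ and $s_1,\dots,s_r\ge 1$ with $s_1\ge 2$, let $$\zeta(s_1,\dots,s_r)=\sum_{n_1>\cdots>n_r\ge 1}\frac{1}{n_1^{s_1}\cdots n_r^{s_r}}$$ be the multiple zeta value, and let $\{1\}^{i}$ denote the string $1,\dots,1$ of $i\ge 0$ ones. **Theorem 1.1.** For all positive integers $m,n,j,k$, $$\begin{aligned} &\zeta(m+1,\{1\}^{j-1})\,\zeta(n+1,\{1\}^{k-1})\\ ={}&\sum_{n_1=0}^{n}\ \sum_{\substack{j_1+j_2=j\\ j_1,j_2\ge 0}}\ \sum_{\substack{\alpha_1+\cdots+\alpha_{j_1+1}=n-n_1+j_1+1\\ \alpha_i\ge 1}}\binom{m-1+n_1}{m-1}\binom{j_2+k-1}{k-1}\,\zeta(\alpha_1+m+n_1,\alpha_2,\dots,\alpha_{j_1+1},\{1\}^{j_2+k-1})\\ &+\sum_{t=0}^{k-1}\ \sum_{\substack{m_1+m_2=m-1\\ m_1,m_2\ge 0}}\ \sum_{\substack{\beta_1+\cdots+\beta_{k-t+1}=m_2+k-t+1\\ \beta_i\ge 1}}\binom{m_1+n-1}{n-1}\binom{j+t}{j}\,\zeta(\beta_1+m_1+n,\beta_2,\dots,\beta_{k-t},\beta_{k-t+1}+1,\{1\}^{j+t-1}),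 \end{aligned}$$ where the $\alpha_i$ and $\beta_i$ are integers, and for $j_1=0$ the string $\alpha_1+m+n_1,\alpha_2,\dots,\alpha_{j_1+1}$ means the single entry $\alpha_1+m+n_1$. -/

import Mathlib

/-- The term `1 / (n₁ ^ s₁ ⋯ n_r ^ s_r)` of the nested sum that defines `ζ(s₁, …, s_r)`. -/
noncomputable def mzvTerm (s : List ℕ) (n : Fin s.length → ℕ) : ℝ :=
  ∏ i, 1 / (n i : ℝ) ^ s.get i

/-- The multiple zeta value `ζ(s₁, …, s_r) = ∑_{n₁ > ⋯ > n_r ≥ 1} 1 / (n₁ ^ s₁ ⋯ n_r ^ s_r)`.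
The series converges when all `s_i ≥ 1` and `s₁ ≥ 2`; see `summable_mzvTerm`. -/
noncomputable def mzv (s : List ℕ) : ℝ :=
  ∑' n : {n : Fin s.length → ℕ // StrictAnti n ∧ ∀ i, 1 ≤ n i}, mzvTerm s n.1

/-- The tuples `(α₁, …, α_r)` of integers `α_i ≥ 1` with `α₁ + ⋯ + α_r = N`. -/
def posTuples (r N : ℕ) : Finset (Fin r → ℕ) :=
  (Finset.Nat.antidiagonalTuple r N).filter fun α => ∀ i, 1 ≤ α i

theorem mem_posTuples {r N : ℕ} {α : Fin r → ℕ} :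
    α ∈ posTuples r N ↔ ∑ i, α i = N ∧ ∀ i, 1 ≤ α i := by
  simp [posTuples, Finset.Nat.mem_antidiagonalTuple]

theorem summable_pi_prod (f : ℕ → ℝ) (hf : Summable f) (h0 : ∀ x, 0 ≤ f x) (r : ℕ) :
    Summable fun n : Fin r → ℕ => ∏ i, f (n i) := by
  induction r with
  | zero => exact Summable.of_finite
  | succ r ih =>
    rw [← (Fin.consEquiv fun _ => ℕ).summable_iff]
    have := hf.mul_of_nonneg ih h0 fun n => Finset.prod_nonneg fun i _ => h0 _
    refine this.congr fun p => ?_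
    simp [Fin.consEquiv, Fin.prod_univ_succ]

/-- The series of `ζ(s₁, …, s_r)` converges (absolutely) if all `s_i ≥ 1` and `s₁ ≥ 2`. -/
theorem summable_mzvTerm (a : ℕ) (s : List ℕ) (ha : 2 ≤ a) (hs : ∀ b ∈ s, 1 ≤ b) :
    Summable fun n : {n : Fin (a :: s).length → ℕ // StrictAnti n ∧ ∀ i, 1 ≤ n i} =>
      mzvTerm (a :: s) n.1 := by
  have hr : (0 : ℝ) < s.length + 1 := by positivity
  have key := summable_pi_prod (fun x : ℕ => (x : ℝ) ^ (-(1 + 1 / (s.length + 1) : ℝ)))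
    (Real.summable_nat_rpow.2 (by have := one_div_pos.2 hr; linarith))
    (fun x => by positivity) (s.length + 1)
  refine Summable.of_nonneg_of_le (fun n => ?_) (fun n => ?_)
    (key.comp_injective Subtype.val_injective)
  · exact Finset.prod_nonneg fun i _ => by positivity
  · obtain ⟨n, hn, hpos⟩ := n
    have hp : ∀ i, (1 : ℝ) ≤ n i := fun i => by exact_mod_cast hpos i
    have h1 : mzvTerm (a :: s) n ≤ (n 0 : ℝ)⁻¹ * ∏ i, (n i : ℝ)⁻¹ := by
      unfold mzvTerm
      change ∏ i : Fin (s.length + 1), _ ≤ _ * ∏ i : Fin (s.length + 1), _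
      rw [Fin.prod_univ_succ, Fin.prod_univ_succ, ← mul_assoc]
      refine mul_le_mul ?_ (Finset.prod_le_prod (fun i _ => by positivity) fun i _ => ?_)
        (Finset.prod_nonneg fun i _ => by positivity) (by positivity)
      · rw [one_div, ← mul_inv, ← sq]
        exact inv_anti₀ (pow_pos (by linarith [hp 0]) _) (pow_le_pow_right₀ (hp 0) ha)
      · rw [one_div]
        exact inv_anti₀ (by linarith [hp i.succ])
          (le_self_pow₀ (hp i.succ) (by have := hs _ (List.get_mem s i); simp at this ⊢; omega))
    refine h1.trans ?_
    have h2 : (n 0 : ℝ)⁻¹ = ∏ _i : Fin (s.length + 1),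
        (n 0 : ℝ) ^ (-(1 / (s.length + 1) : ℝ)) := by
      rw [Finset.prod_const, Finset.card_univ, Fintype.card_fin, ← Real.rpow_natCast,
        ← Real.rpow_mul (by positivity), ← Real.rpow_neg_one]
      congr 1
      push_cast
      field_simp
    rw [h2]
    change _ * ∏ i : Fin (s.length + 1), _ ≤ ∏ i : Fin (s.length + 1), _
    rw [← Finset.prod_mul_distrib]
    refine Finset.prod_le_prod (fun i _ => by positivity) fun i _ => ?_
    have hi : (0 : ℝ) < n i := by linarith [hp i]
    rw [neg_add, Real.rpow_add hi, Real.rpow_neg_one, mul_comm]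
    refine mul_le_mul_of_nonneg_left ?_ (by positivity)
    refine Real.rpow_le_rpow_of_nonpos hi ?_ (by have := one_div_pos.2 hr; linarith)
    exact_mod_cast hn.antitone (Fin.zero_le i)

/-! Write `A` and `B` for integration against dz/z and dz/(1-z). A multiple zeta value is the
coefficient sum of the power series of a word in `A`, `B` applied to 1, and each factor on the left
is the case A^m B^j 1. Integration by parts, an identity of formal power series, shuffles products
of such series. Stripping leading `A`s, the product obeys u(m,n) = A u(m-1,n) + A u(m,n-1), a
lattice walk that ends when one factor has no `A` left (`heightOne_succ_mul_heightOne`). There B^j 1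
times A^n B^k 1 expands directly (`heightOne_zero_mul_heightOne`,
`heightOne_succ_mul_heightOne_zero`). Path counts and interleavings of `B`s give the two binomials
in each term.

Coefficients are nonnegative, so summing them ("z = 1") respects products by absolute convergence,
without a limit z → 1 (`hasSum_coeff_multiPolylog`, `hasSum_coeff_mul`). -/

open PowerSeries in
/-- The operator `f ↦ ∫ f dz / z` on power series without constant term. -/
noncomputable def intDivX : Module.End ℝ (PowerSeries ℝ) where
  toFun f := PowerSeries.mk fun n => coeff n f / n
  map_add' f g := by ext n; simp [add_div]
  map_smul' c f := by ext n; simp [mul_div_assoc]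

open PowerSeries in
/-- The operator `f ↦ ∫ f dz / (1 - z)` on power series. -/
noncomputable def intDivOneSub : Module.End ℝ (PowerSeries ℝ) where
  toFun f := PowerSeries.mk fun n => (∑ i ∈ Finset.range n, coeff i f) / n
  map_add' f g := by ext n; simp [Finset.sum_add_distrib, add_div]
  map_smul' c f := by ext n; simp [← Finset.mul_sum, mul_div_assoc]

/-! ### Integration by parts for formal power series -/

section Operators

open PowerSeries

local notation "A" => intDivX
local notation "B" => intDivOneSub

theorem coeff_intDivX (f : PowerSeries ℝ) (n : ℕ) : coeff n (A f) = coeff n f / n := by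
  simp [intDivX]

theorem coeff_intDivOneSub (f : PowerSeries ℝ) (n : ℕ) :
    coeff n (B f) = (∑ i ∈ Finset.range n, coeff i f) / n := by
  simp [intDivOneSub]

theorem constantCoeff_intDivX (f : PowerSeries ℝ) : constantCoeff (A f) = 0 := by
  rw [← coeff_zero_eq_constantCoeff_apply, coeff_intDivX]; simp

theorem constantCoeff_intDivOneSub (f : PowerSeries ℝ) : constantCoeff (B f) = 0 := by
  rw [← coeff_zero_eq_constantCoeff_apply, coeff_intDivOneSub]; simp

theorem X_mul_derivative_intDivX {f : PowerSeries ℝ} (hf : constantCoeff f = 0) :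
    X * d⁄dX ℝ (A f) = f := by
  ext n
  cases n with
  | zero => simp [hf]
  | succ n =>
    rw [coeff_succ_X_mul, coeff_derivative, coeff_intDivX]
    push_cast
    field_simp

theorem one_sub_X_mul_derivative_intDivOneSub (f : PowerSeries ℝ) :
    (1 - X) * d⁄dX ℝ (B f) = f := by
  have h : ∀ n, coeff n (d⁄dX ℝ (B f)) = ∑ i ∈ Finset.range (n + 1), coeff i f := fun n => by
    rw [coeff_derivative, coeff_intDivOneSub]
    push_cast
    field_simp
  ext n
  rw [sub_mul, one_mul, map_sub, h]
  cases n with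
  | zero => simp
  | succ n => rw [coeff_succ_X_mul, h, Finset.sum_range_succ]; ring

theorem one_sub_X_ne_zero : (1 - X : PowerSeries ℝ) ≠ 0 := fun h => by
  simpa using congrArg constantCoeff h

/-- Leibniz rule: both sides have constant term 0 and, after cancelling the nonzero factor X, the
same derivative. Constant terms must vanish because `A` discards them (division by 0 is 0). -/
theorem intDivX_mul_intDivX {f g : PowerSeries ℝ} (hf : constantCoeff f = 0)
    (hg : constantCoeff g = 0) : A f * A g = A (f * A g) + A (A f * g) := by
  refine derivative.ext (mul_left_cancel₀ X_ne_zero ?_) (by simp [constantCoeff_intDivX])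
  have h1 := X_mul_derivative_intDivX hf
  have h2 := X_mul_derivative_intDivX hg
  have h3 := X_mul_derivative_intDivX (f := f * A g) (by simp [hf])
  have h4 := X_mul_derivative_intDivX (f := A f * g) (by simp [hg])
  simp only [Derivation.leibniz, map_add, smul_eq_mul]
  linear_combination A g * h1 + A f * h2 - h3 - h4

theorem intDivX_mul_intDivOneSub {f : PowerSeries ℝ} (g : PowerSeries ℝ)
    (hf : constantCoeff f = 0) : A f * B g = A (f * B g) + B (A f * g) := by
  refine derivative.ext (mul_left_cancel₀ (mul_ne_zero X_ne_zero one_sub_X_ne_zero) ?_)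
    (by simp [constantCoeff_intDivX, constantCoeff_intDivOneSub])
  have h1 := X_mul_derivative_intDivX hf
  have h2 := one_sub_X_mul_derivative_intDivOneSub g
  have h3 := X_mul_derivative_intDivX (f := f * B g) (by simp [hf])
  have h4 := one_sub_X_mul_derivative_intDivOneSub (A f * g)
  simp only [Derivation.leibniz, map_add, smul_eq_mul]
  linear_combination (1 - X) * B g * h1 + X * A f * h2 - (1 - X) * h3 - X * h4

theorem intDivOneSub_mul_intDivOneSub (f g : PowerSeries ℝ) :
    B f * B g = B (f * B g) + B (B f * g) := by
  refine derivative.ext (mul_left_cancel₀ one_sub_X_ne_zero ?_)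
    (by simp [constantCoeff_intDivOneSub])
  have h1 := one_sub_X_mul_derivative_intDivOneSub f
  have h2 := one_sub_X_mul_derivative_intDivOneSub g
  have h3 := one_sub_X_mul_derivative_intDivOneSub (f * B g)
  have h4 := one_sub_X_mul_derivative_intDivOneSub (B f * g)
  simp only [Derivation.leibniz, map_add, smul_eq_mul]
  linear_combination B g * h1 + B f * h2 - h3 - h4

theorem constantCoeff_intDivX_pow {f : PowerSeries ℝ} (hf : constantCoeff f = 0) (n : ℕ) :
    constantCoeff ((A ^ n) f) = 0 := by
  cases n with
  | zero => simpa
  | succ n => rw [pow_succ', Module.End.mul_apply, constantCoeff_intDivX]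

theorem constantCoeff_intDivX_pow_intDivOneSub_pow (n k : ℕ) :
    constantCoeff ((A ^ n) ((B ^ (k + 1)) 1)) = 0 :=
  constantCoeff_intDivX_pow
    (by rw [pow_succ', Module.End.mul_apply, constantCoeff_intDivOneSub]) n

end Operators

/-! ### Shuffles of two powers and compositions -/

/-- The shuffle product of `x ^ p` and `y ^ q`: the sum of all words in `x`, `y` that contain
`x` exactly `p` times and `y` exactly `q` times. -/
def shufflePow {R : Type*} [Semiring R] (x y : R) : ℕ → ℕ → R
  | 0, 0 => 1
  | p + 1, 0 => x * shufflePow x y p 0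
  | 0, q + 1 => y * shufflePow x y 0 q
  | p + 1, q + 1 => x * shufflePow x y p (q + 1) + y * shufflePow x y (p + 1) q

section ShufflePow

variable {R : Type*} [Semiring R] (x y : R)

theorem shufflePow_zero_right (p : ℕ) : shufflePow x y p 0 = x ^ p := by
  induction p with
  | zero => simp [shufflePow]
  | succ p ih => rw [shufflePow, ih, pow_succ']

/-- Each word is cut at its first `y`. -/
theorem shufflePow_succ_right (p q : ℕ) : shufflePow x y p (q + 1) =
    ∑ a ∈ Finset.HasAntidiagonal.antidiagonal p, x ^ a.1 * (y * shufflePow x y a.2 q) := by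
  induction p with
  | zero => simp [shufflePow]
  | succ p ih =>
    rw [shufflePow, ih, Finset.Nat.sum_antidiagonal_succ, Finset.mul_sum, add_comm]
    simp [pow_succ', mul_assoc]

/-- The word `x ^ a₀ * y * x ^ a₁ * y * ⋯ * y * x ^ a_q`. -/
def tupleWord : (q : ℕ) → (Fin (q + 1) → ℕ) → R
  | 0, a => x ^ a 0
  | q + 1, a => x ^ a 0 * (y * tupleWord q (Fin.tail a))

theorem sum_antidiagonalTuple_succ {M : Type*} [AddCommMonoid M] (r N : ℕ)
    (F : (Fin (r + 1) → ℕ) → M) :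
    ∑ a ∈ Finset.Nat.antidiagonalTuple (r + 1) N, F a =
      ∑ p ∈ Finset.HasAntidiagonal.antidiagonal N, ∑ a ∈ Finset.Nat.antidiagonalTuple r p.2,
        F (Fin.cons p.1 a) := by
  rw [Finset.sum_sigma']
  refine Finset.sum_bij' (fun a _ => ⟨(a 0, ∑ i, Fin.tail a i), Fin.tail a⟩)
    (fun b _ => Fin.cons b.1.1 b.2) ?_ ?_ ?_ ?_ ?_
  · intro a ha
    rw [Finset.Nat.mem_antidiagonalTuple, Fin.sum_univ_succ] at ha
    simp [Finset.Nat.mem_antidiagonalTuple, Fin.tail, ha]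
  · rintro ⟨⟨u, v⟩, a⟩ h
    simp only [Finset.mem_sigma, Finset.HasAntidiagonal.mem_antidiagonal,
      Finset.Nat.mem_antidiagonalTuple] at h
    simp [Finset.Nat.mem_antidiagonalTuple, Fin.sum_univ_succ, h.2, h.1]
  · intro a _
    exact Fin.cons_self_tail a
  · rintro ⟨⟨u, v⟩, a⟩ h
    simp only [Finset.mem_sigma, Finset.HasAntidiagonal.mem_antidiagonal,
      Finset.Nat.mem_antidiagonalTuple] at h
    obtain ⟨-, rfl⟩ := h
    simp
  · intro a _
    simp

theorem shufflePow_eq_sum_tupleWord (p q : ℕ) : shufflePow x y p q =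
    ∑ a ∈ Finset.Nat.antidiagonalTuple (q + 1) p, tupleWord x y q a := by
  induction q generalizing p with
  | zero => simp [shufflePow_zero_right, tupleWord]
  | succ q ih =>
    rw [shufflePow_succ_right, sum_antidiagonalTuple_succ]
    simp [tupleWord, ih, Finset.mul_sum]

end ShufflePow

theorem sum_posTuples {M : Type*} [AddCommMonoid M] (r N : ℕ) (F : (Fin r → ℕ) → M) :
    ∑ α ∈ posTuples r (N + r), F α =
      ∑ a ∈ Finset.Nat.antidiagonalTuple r N, F (fun i => a i + 1) := by
  refine Finset.sum_bij' (fun α _ i => α i - 1) (fun a _ i => a i + 1) ?_ ?_ ?_ ?_ ?_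
  · intro α h
    obtain ⟨h, h1⟩ := mem_posTuples.1 h
    rw [Finset.Nat.mem_antidiagonalTuple]
    have : ∑ i, α i = ∑ i, (α i - 1) + r := by
      rw [Finset.sum_congr rfl fun i _ => (Nat.sub_add_cancel (h1 i)).symm]
      simp [Finset.sum_add_distrib]
    omega
  · intro a h
    rw [Finset.Nat.mem_antidiagonalTuple] at h
    simp [mem_posTuples, Finset.sum_add_distrib, h]
  · intro α h
    funext i
    exact Nat.sub_add_cancel ((mem_posTuples.1 h).2 i)
  · intro a _
    simp
  · intro α h
    congr 1
    funext i
    exact (Nat.sub_add_cancel ((mem_posTuples.1 h).2 i)).symm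

/-! ### Expansion of the product into words -/

section Expansion

open PowerSeries

/-- `∑ (x ^ n ⧢ y ^ j₁) (f j₂)` over `j₁ + j₂ = j`. -/
noncomputable def shuffleConv (f : ℕ → PowerSeries ℝ) (n j : ℕ) : PowerSeries ℝ :=
  ∑ p ∈ Finset.HasAntidiagonal.antidiagonal j,
    shufflePow intDivX intDivOneSub n p.1 (f p.2)

local notation "A" => intDivX
local notation "B" => intDivOneSub

theorem shuffleConv_zero_zero (f : ℕ → PowerSeries ℝ) : shuffleConv f 0 0 = f 0 := by
  simp [shuffleConv, shufflePow]

theorem shuffleConv_succ_zero (f : ℕ → PowerSeries ℝ) (n : ℕ) :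
    shuffleConv f (n + 1) 0 = A (shuffleConv f n 0) := by
  simp [shuffleConv, shufflePow]

theorem shuffleConv_zero_succ (f : ℕ → PowerSeries ℝ) (j : ℕ) :
    shuffleConv f 0 (j + 1) = f (j + 1) + B (shuffleConv f 0 j) := by
  simp [shuffleConv, shufflePow, Finset.Nat.sum_antidiagonal_succ]

theorem shuffleConv_succ_succ (f : ℕ → PowerSeries ℝ) (n j : ℕ) :
    shuffleConv f (n + 1) (j + 1) = A (shuffleConv f n (j + 1)) + B (shuffleConv f (n + 1) j) := by
  simp [shuffleConv, shufflePow, Finset.Nat.sum_antidiagonal_succ, Finset.sum_add_distrib,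
    add_assoc]

theorem intDivOneSub_pow_mul_pow (j k : ℕ) :
    (B ^ j) 1 * (B ^ k) 1 = (j + k).choose j • (B ^ (j + k)) 1 := by
  induction j generalizing k with
  | zero => simp
  | succ j ihj =>
    induction k with
    | zero => simp
    | succ k ihk =>
      rw [pow_succ' B j, pow_succ' B k, Module.End.mul_apply, Module.End.mul_apply,
        intDivOneSub_mul_intDivOneSub, ← Module.End.mul_apply, ← Module.End.mul_apply,
        ← pow_succ', ← pow_succ', ihj, ihk, map_nsmul, map_nsmul, ← Module.End.mul_apply,
        ← Module.End.mul_apply, ← pow_succ', ← pow_succ',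
        show j + (k + 1) + 1 = j + 1 + (k + 1) by ring, show j + 1 + k + 1 = j + 1 + (k + 1) by ring,
        ← add_smul, show j + 1 + (k + 1) = j + (k + 1) + 1 by ring, Nat.choose_succ_succ,
        show j + 1 + k = j + (k + 1) by ring]

/-- The power series `∫ x ^ n y ^ k` with `x = dz / z` and `y = dz / (1 - z)`. -/
noncomputable def heightOne (n k : ℕ) : PowerSeries ℝ := (A ^ n) ((B ^ k) 1)

theorem heightOne_succ (n k : ℕ) : heightOne (n + 1) k = A (heightOne n k) := by
  rw [heightOne, pow_succ', Module.End.mul_apply, heightOne]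

theorem heightOne_zero_succ (k : ℕ) : heightOne 0 (k + 1) = B (heightOne 0 k) := by
  simp [heightOne, pow_succ']

theorem constantCoeff_heightOne (n k : ℕ) : constantCoeff (heightOne n (k + 1)) = 0 :=
  constantCoeff_intDivX_pow_intDivOneSub_pow n k

theorem heightOne_zero_mul (j k : ℕ) :
    heightOne 0 j * heightOne 0 k = (j + k).choose j • heightOne 0 (j + k) :=
  intDivOneSub_pow_mul_pow j k

/-- Cut each shuffle just before the first `B` of the right factor: all `n` letters `A` precede it,
and the `t + k` letters `B` after it interleave freely. -/
theorem heightOne_zero_mul_heightOne (j n k : ℕ) :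
    heightOne 0 j * heightOne n (k + 1) =
      shuffleConv (fun t => (t + k).choose k • heightOne 0 (t + k + 1)) n j := by
  induction n generalizing j with
  | zero =>
    induction j with
    | zero => simp [shuffleConv_zero_zero, heightOne]
    | succ j ih =>
      rw [shuffleConv_zero_succ, ← ih, heightOne_zero_mul, heightOne_zero_mul, map_nsmul,
        ← heightOne_zero_succ, ← add_assoc, show j + 1 + k = j + k + 1 by ring,
        show j + (k + 1) = j + k + 1 by ring, ← add_smul]
      congr 1
      rw [← Nat.choose_symm_of_eq_add (show j + k + 1 + 1 = (k + 1) + (j + 1) by ring),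
        ← Nat.choose_symm_of_eq_add (show j + k + 1 = (k + 1) + j by ring)]
      exact Nat.choose_succ_succ _ _
  | succ n ihn =>
    induction j with
    | zero =>
      rw [shuffleConv_succ_zero, ← ihn]
      simp [heightOne_succ, show heightOne 0 0 = 1 by simp [heightOne]]
    | succ j ihj =>
      rw [shuffleConv_succ_succ, ← ihn, ← ihj, heightOne_succ, heightOne_zero_succ, mul_comm,
        intDivX_mul_intDivOneSub _ (constantCoeff_heightOne n k)]
      simp only [mul_comm]

/-- Here the cut is just before the last `A` of the left factor; after it only `B`s interleave. -/
theorem heightOne_succ_mul_heightOne_zero (m j k : ℕ) :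
    heightOne (m + 1) (j + 1) * heightOne 0 k =
      shuffleConv (fun t => (j + 1 + t).choose (j + 1) • heightOne 1 (j + 1 + t)) m k := by
  induction m generalizing k with
  | zero =>
    induction k with
    | zero => simp [shuffleConv_zero_zero, show heightOne 0 0 = 1 by simp [heightOne]]
    | succ k ih =>
      rw [shuffleConv_zero_succ, ← ih, heightOne_succ, heightOne_zero_succ k,
        intDivX_mul_intDivOneSub _ (constantCoeff_heightOne 0 j), ← heightOne_zero_succ,
        heightOne_zero_mul, map_nsmul, ← heightOne_succ]
  | succ m ihm =>
    induction k with
    | zero =>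
      rw [shuffleConv_succ_zero, ← ihm]
      simp [heightOne_succ, show heightOne 0 0 = 1 by simp [heightOne]]
    | succ k ihk =>
      rw [shuffleConv_succ_succ, ← ihm, ← ihk, heightOne_succ (m + 1), heightOne_zero_succ,
        intDivX_mul_intDivOneSub _ (constantCoeff_heightOne (m + 1) j)]

/-- The solution of the recursion `u (m + 1) (n + 1) = A (u m (n + 1) + u (m + 1) n)` with
`u 0 n = f n` and `u (m + 1) 0 = A (u m 0)`. -/
noncomputable def latticeSum (f : ℕ → PowerSeries ℝ) (m n : ℕ) : PowerSeries ℝ :=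
  ∑ p ∈ Finset.HasAntidiagonal.antidiagonal n, m.multichoose p.1 • (A ^ (m + p.1)) (f p.2)

theorem latticeSum_zero_left (f : ℕ → PowerSeries ℝ) (n : ℕ) : latticeSum f 0 n = f n := by
  cases n with
  | zero => simp [latticeSum]
  | succ n => simp [latticeSum, Finset.Nat.sum_antidiagonal_succ]

theorem latticeSum_zero_right (f : ℕ → PowerSeries ℝ) (m : ℕ) :
    latticeSum f m 0 = (A ^ m) (f 0) := by
  simp [latticeSum]

/-- `m.multichoose i` counts paths with `m` steps in the first coordinate and `i` in the second
whose last step, if any, is of the first kind; Pascal's rule gives the recursion. -/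
theorem latticeSum_succ_succ (f : ℕ → PowerSeries ℝ) (m n : ℕ) :
    latticeSum f (m + 1) (n + 1) = A (latticeSum f m (n + 1)) + A (latticeSum f (m + 1) n) := by
  simp only [latticeSum, Finset.Nat.sum_antidiagonal_succ, Nat.multichoose_succ_succ, map_add,
    map_sum, map_nsmul, ← Module.End.mul_apply, ← pow_succ', add_smul, Finset.sum_add_distrib,
    Nat.multichoose_zero_right, add_assoc]
  simp only [add_comm, add_left_comm]

theorem heightOne_succ_mul_heightOne (m n j k : ℕ) :
    heightOne (m + 1) (j + 1) * heightOne n (k + 1) =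
      latticeSum (fun b => shuffleConv
        (fun t => (t + k).choose k • heightOne 0 (t + k + 1)) b (j + 1)) (m + 1) n +
      latticeSum (fun b => ∑ p ∈ Finset.HasAntidiagonal.antidiagonal k,
        shufflePow A B b (p.1 + 1)
          ((j + 1 + p.2).choose (j + 1) • heightOne 1 (j + 1 + p.2))) n m := by
  induction n generalizing m with
  | zero =>
    -- The word without a `B` before the cut is the corner term of the first lattice sum; this is
    -- why the second one carries `p.1 + 1`.
    rw [latticeSum_zero_right, latticeSum_zero_left, heightOne_succ_mul_heightOne_zero,
      ← heightOne_zero_mul_heightOne, heightOne_zero_mul, shuffleConv,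
      Finset.Nat.sum_antidiagonal_succ, shufflePow_zero_right]
    simp only [map_nsmul]
    congr 2
  | succ n ihn =>
    rw [heightOne_succ, heightOne_succ, intDivX_mul_intDivX (constantCoeff_heightOne m j)
      (constantCoeff_heightOne n k), ← heightOne_succ, ← heightOne_succ, ihn,
      latticeSum_succ_succ]
    induction m with
    | zero =>
      rw [heightOne_zero_mul_heightOne, latticeSum_zero_left, latticeSum_zero_right,
        latticeSum_zero_right, pow_succ', Module.End.mul_apply, map_add, add_assoc]
    | succ m ihm =>
      rw [latticeSum_succ_succ _ n m, heightOne_succ m, heightOne_succ n,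
        intDivX_mul_intDivX (constantCoeff_heightOne m j) (constantCoeff_heightOne n k),
        ← heightOne_succ, ← heightOne_succ, ihn, ihm, latticeSum_succ_succ _ m n]
      simp only [map_add]
      abel

end Expansion

/-! ### Multiple zeta values as coefficient sums -/

section Series

open PowerSeries

/-- The multiple polylogarithm `∑ z ^ n₁ / (n₁ ^ s₁ ⋯ n_r ^ s_r)` as a power series. -/
noncomputable def multiPolylog : List ℕ → PowerSeries ℝ
  | [] => 1
  | a :: s => (intDivX ^ (a - 1)) (intDivOneSub (multiPolylog s))

theorem coeff_intDivX_pow (a : ℕ) (f : PowerSeries ℝ) (n : ℕ) :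
    coeff n ((intDivX ^ a) f) = coeff n f / (n : ℝ) ^ a := by
  induction a with
  | zero => simp
  | succ a ih =>
    rw [pow_succ' intDivX, Module.End.mul_apply, coeff_intDivX, ih, pow_succ, div_div]

theorem coeff_multiPolylog_cons {a : ℕ} (ha : 1 ≤ a) (s : List ℕ) (n : ℕ) :
    coeff n (multiPolylog (a :: s)) =
      (∑ i ∈ Finset.range n, coeff i (multiPolylog s)) / (n : ℝ) ^ a := by
  obtain ⟨a, rfl⟩ := Nat.exists_eq_add_of_le' ha
  rw [multiPolylog, coeff_intDivX_pow, coeff_intDivOneSub, div_div, ← pow_succ']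
  rfl

/-- The strictly decreasing tuples of `r` integers in `[1, N]`. -/
def decTuples (r N : ℕ) : Finset (Fin r → ℕ) :=
  (Fintype.piFinset fun _ => Finset.Icc 1 N).filter fun n => StrictAnti n

theorem mem_decTuples {r N : ℕ} {n : Fin r → ℕ} :
    n ∈ decTuples r N ↔ StrictAnti n ∧ ∀ i, 1 ≤ n i ∧ n i ≤ N := by
  simp [decTuples, and_comm]

theorem strictAnti_cons {r : ℕ} {x : ℕ} {n : Fin r → ℕ} :
    StrictAnti (Fin.cons x n : Fin (r + 1) → ℕ) ↔ StrictAnti n ∧ ∀ i, n i < x := by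
  constructor
  · intro h
    exact ⟨fun i j hij => by simpa using h (Fin.succ_lt_succ_iff.2 hij),
      fun i => by simpa using h (Fin.succ_pos i)⟩
  · rintro ⟨h, hx⟩ i j hij
    cases j using Fin.cases with
    | zero => exact absurd hij (Fin.not_lt_zero i)
    | succ j =>
      cases i using Fin.cases with
      | zero => simpa using hx j
      | succ i => simpa using h (Fin.succ_lt_succ_iff.1 hij)

theorem sum_decTuples_succ {M : Type*} [AddCommMonoid M] (r N : ℕ)
    (F : (Fin (r + 1) → ℕ) → M) :
    ∑ n ∈ decTuples (r + 1) N, F n =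
      ∑ x ∈ Finset.range N, ∑ n ∈ decTuples r x, F (Fin.cons (x + 1) n) := by
  rw [Finset.sum_sigma']
  refine Finset.sum_bij' (fun n _ => ⟨n 0 - 1, Fin.tail n⟩)
    (fun b _ => Fin.cons (b.1 + 1) b.2) ?_ ?_ ?_ ?_ ?_
  · intro n hn
    obtain ⟨h, hb⟩ := mem_decTuples.1 hn
    have h0 := hb 0
    refine Finset.mem_sigma.2 ⟨Finset.mem_range.2 (show n 0 - 1 < N by omega),
      mem_decTuples.2 ⟨?_, fun i => ?_⟩⟩
    · exact fun i j hij => h (Fin.succ_lt_succ_iff.2 hij)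
    · have h1 := h (Fin.succ_pos i)
      have h2 := hb i.succ
      simp only [Fin.tail]
      omega
  · rintro ⟨x, n⟩ hn
    simp only [Finset.mem_sigma, Finset.mem_range, mem_decTuples] at hn
    refine mem_decTuples.2 ⟨strictAnti_cons.2 ⟨hn.2.1, fun i => ?_⟩, fun i => ?_⟩
    · exact Nat.lt_succ_of_le (hn.2.2 i).2
    · cases i using Fin.cases with
      | zero => simp; omega
      | succ i =>
        have := hn.2.2 i
        simp only [Fin.cons_succ]
        omega
  · intro n hn
    have h0 := (mem_decTuples.1 hn).2 0
    simp only [Nat.sub_add_cancel h0.1]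
    exact Fin.cons_self_tail n
  · rintro ⟨x, n⟩ _
    simp
  · intro n hn
    have h0 := (mem_decTuples.1 hn).2 0
    simp only [Nat.sub_add_cancel h0.1]
    rw [Fin.cons_self_tail n]

theorem mzvTerm_cons (a : ℕ) (s : List ℕ) (x : ℕ) (n : Fin s.length → ℕ) :
    mzvTerm (a :: s) (Fin.cons x n : Fin (s.length + 1) → ℕ) = mzvTerm s n / (x : ℝ) ^ a := by
  unfold mzvTerm
  change ∏ i : Fin (s.length + 1), _ = _
  rw [Fin.prod_univ_succ, div_eq_inv_mul (∏ i, _), ← one_div]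
  rfl

/-- The `i`-th coefficient collects the tuples with largest entry `i`; index 0 matters only for the
empty list. -/
theorem sum_decTuples_mzvTerm (s : List ℕ) (hs : ∀ b ∈ s, 1 ≤ b) (N : ℕ) :
    ∑ n ∈ decTuples s.length N, mzvTerm s n =
      ∑ i ∈ Finset.range (N + 1), coeff i (multiPolylog s) := by
  induction s generalizing N with
  | nil =>
    have : decTuples ([] : List ℕ).length N = {Fin.elim0} := by
      ext n
      simp only [mem_decTuples, Finset.mem_singleton]
      exact ⟨fun _ => funext fun i => i.elim0, fun _ => ⟨fun i => i.elim0, fun i => i.elim0⟩⟩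
    rw [this, Finset.sum_singleton, multiPolylog, Finset.sum_range_succ']
    simp [mzvTerm, coeff_one]
  | cons a s ih =>
    have ha : 1 ≤ a := hs a (by simp)
    rw [Finset.sum_range_succ', coeff_multiPolylog_cons ha]
    refine (sum_decTuples_succ s.length N (mzvTerm (a :: s))).trans ?_
    simp only [Finset.range_zero, Finset.sum_empty, zero_div, add_zero]
    refine Finset.sum_congr rfl fun x _ => ?_
    rw [coeff_multiPolylog_cons ha, ← ih (fun b hb => hs b (by simp [hb])), Finset.sum_div]
    exact Finset.sum_congr rfl fun n _ => mzvTerm_cons a s (x + 1) n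

theorem coeff_multiPolylog_nonneg (s : List ℕ) (n : ℕ) : 0 ≤ coeff n (multiPolylog s) := by
  induction s generalizing n with
  | nil => rw [multiPolylog, coeff_one]; split_ifs <;> norm_num
  | cons a s ih =>
    rw [multiPolylog, coeff_intDivX_pow, coeff_intDivOneSub]
    exact div_nonneg (div_nonneg (Finset.sum_nonneg fun i _ => ih i) (by positivity))
      (by positivity)

theorem hasSum_coeff_multiPolylog {a : ℕ} {s : List ℕ} (ha : 2 ≤ a) (hs : ∀ b ∈ s, 1 ≤ b) :
    HasSum (fun n => coeff n (multiPolylog (a :: s))) (mzv (a :: s)) := by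
  have hs' : ∀ b ∈ a :: s, 1 ≤ b := by
    simp only [List.mem_cons, forall_eq_or_imp]
    exact ⟨by omega, hs⟩
  rw [hasSum_iff_tendsto_nat_of_nonneg (coeff_multiPolylog_nonneg _),
    ← Filter.tendsto_add_atTop_iff_nat 1]
  simp_rw [← sum_decTuples_mzvTerm _ hs']
  let D : ℕ → Finset {n : Fin (a :: s).length → ℕ // StrictAnti n ∧ ∀ i, 1 ≤ n i} := fun N =>
    (decTuples (a :: s).length N).subtype _
  have hD : Filter.Tendsto D Filter.atTop Filter.atTop := by
    refine Filter.tendsto_atTop_finset_of_monotone (fun N N' h x hx => ?_) fun x => ?_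
    · simp only [D, Finset.mem_subtype, mem_decTuples] at hx ⊢
      exact ⟨hx.1, fun i => ⟨(hx.2 i).1, (hx.2 i).2.trans h⟩⟩
    -- The sum of the entries bounds each entry.
    · refine ⟨∑ i, x.1 i, ?_⟩
      simp only [D, Finset.mem_subtype, mem_decTuples]
      exact ⟨x.2.1, fun i => ⟨x.2.2 i,
        Finset.single_le_sum (fun _ _ => Nat.zero_le _) (Finset.mem_univ i)⟩⟩
  refine ((summable_mzvTerm a s ha hs).hasSum.comp hD).congr fun N => ?_
  simp only [D, Function.comp]
  refine Finset.sum_subtype_of_mem (mzvTerm (a :: s)) fun n hn => ?_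
  rw [mem_decTuples] at hn
  exact ⟨hn.1, fun i => (hn.2 i).1⟩

theorem hasSum_coeff_mul {f g : PowerSeries ℝ} {x y : ℝ} (hf : HasSum (fun n => coeff n f) x)
    (hg : HasSum (fun n => coeff n g) y) (hf0 : ∀ n, 0 ≤ coeff n f) (hg0 : ∀ n, 0 ≤ coeff n g) :
    HasSum (fun n => coeff n (f * g)) (x * y) := by
  have hf' : Summable fun n => ‖coeff n f‖ := by
    simpa only [Real.norm_of_nonneg (hf0 _)] using hf.summable
  have hg' : Summable fun n => ‖coeff n g‖ := by
    simpa only [Real.norm_of_nonneg (hg0 _)] using hg.summable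
  simp_rw [coeff_mul]
  rw [← hf.tsum_eq, ← hg.tsum_eq,
    tsum_mul_tsum_eq_tsum_sum_antidiagonal_of_summable_norm hf' hg']
  exact (summable_norm_sum_mul_antidiagonal_of_summable_norm hf' hg').of_norm.hasSum

/-! ### Index strings as words in the two operators -/

theorem multiPolylog_replicate_one (d : ℕ) :
    multiPolylog (List.replicate d 1) = heightOne 0 d := by
  induction d with
  | zero => simp [multiPolylog, heightOne]
  | succ d ih => simp [List.replicate_succ, multiPolylog, ih, heightOne_zero_succ]

theorem multiPolylog_cons_replicate_one (m j : ℕ) :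
    multiPolylog ((m + 1) :: List.replicate j 1) = heightOne m (j + 1) := by
  rw [multiPolylog, multiPolylog_replicate_one, heightOne, heightOne,
    pow_succ' intDivOneSub, Module.End.mul_apply]
  simp

theorem multiPolylog_add_cons (c a : ℕ) (ha : 1 ≤ a) (s : List ℕ) :
    multiPolylog ((a + c) :: s) = (intDivX ^ c) (multiPolylog (a :: s)) := by
  rw [multiPolylog, multiPolylog, ← Module.End.mul_apply (intDivX ^ c), ← pow_add,
    show a + c - 1 = c + (a - 1) by omega]

theorem multiPolylog_ofFn_append (q : ℕ) (a : Fin (q + 1) → ℕ) (l : List ℕ) :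
    multiPolylog (List.ofFn (fun i => a i + 1) ++ l) =
      tupleWord intDivX intDivOneSub q a (intDivOneSub (multiPolylog l)) := by
  induction q with
  | zero => simp [multiPolylog, tupleWord]
  | succ q ih =>
    rw [List.ofFn_succ, List.cons_append, multiPolylog, tupleWord, Module.End.mul_apply,
      Module.End.mul_apply, ← ih (Fin.tail a)]
    rfl

/-- Raising the last entry inserts an `intDivX` just before the final `intDivOneSub` of the block.
-/
theorem multiPolylog_ofFn_add_single_last_append (q : ℕ) (a : Fin (q + 1) → ℕ) (l : List ℕ) :
    multiPolylog (List.ofFn ((fun i => a i + 1) + Pi.single (Fin.last q) 1) ++ l) =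
      tupleWord intDivX intDivOneSub q a (intDivX (intDivOneSub (multiPolylog l))) := by
  induction q with
  | zero => simp [multiPolylog, tupleWord, pow_succ]
  | succ q ih =>
    have h : (fun i : Fin (q + 1) =>
        ((fun i => a i + 1) + Pi.single (Fin.last (q + 1)) 1 : Fin (q + 2) → ℕ) i.succ) =
        (fun i => Fin.tail a i + 1) + Pi.single (Fin.last q) 1 := by
      funext i
      simp [Pi.single_apply, Fin.tail]
    rw [List.ofFn_succ, List.cons_append, multiPolylog, tupleWord, Module.End.mul_apply,
      Module.End.mul_apply, ← ih (Fin.tail a), h]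
    simp [Pi.single_apply]

theorem multiPolylog_ofFn_add_single_zero_append (q c : ℕ) (α : Fin (q + 1) → ℕ) (l : List ℕ)
    (h : 1 ≤ α 0) : multiPolylog (List.ofFn (α + Pi.single 0 c) ++ l) =
      (intDivX ^ c) (multiPolylog (List.ofFn α ++ l)) := by
  rw [List.ofFn_succ, List.ofFn_succ, List.cons_append, List.cons_append, Pi.add_apply,
    Pi.single_eq_same, multiPolylog_add_cons _ _ h]
  simp

theorem sum_posTuples_multiPolylog {q p N : ℕ} (c d : ℕ) (hN : N = p + (q + 1)) :
    ∑ α ∈ posTuples (q + 1) N,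
      multiPolylog (List.ofFn (α + Pi.single 0 c) ++ List.replicate d 1) =
      (intDivX ^ c) (shufflePow intDivX intDivOneSub p q (heightOne 0 (d + 1))) := by
  rw [hN, sum_posTuples, shufflePow_eq_sum_tupleWord, LinearMap.sum_apply, map_sum]
  refine Finset.sum_congr rfl fun a _ => ?_
  rw [multiPolylog_ofFn_add_single_zero_append _ _ _ _ (by simp), multiPolylog_ofFn_append,
    multiPolylog_replicate_one, heightOne_zero_succ]

theorem sum_posTuples_multiPolylog_last {q p N : ℕ} (c d : ℕ) (hN : N = p + (q + 1)) :
    ∑ β ∈ posTuples (q + 1) N,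
      multiPolylog (List.ofFn (β + Pi.single 0 c + Pi.single (Fin.last q) 1) ++
        List.replicate d 1) =
      (intDivX ^ c) (shufflePow intDivX intDivOneSub p q (heightOne 1 (d + 1))) := by
  rw [hN, sum_posTuples, shufflePow_eq_sum_tupleWord, LinearMap.sum_apply, map_sum]
  refine Finset.sum_congr rfl fun a _ => ?_
  rw [add_right_comm, multiPolylog_ofFn_add_single_zero_append _ _ _ _
      (le_add_right (Nat.le_add_left 1 (a 0))),
    multiPolylog_ofFn_add_single_last_append, multiPolylog_replicate_one, heightOne_succ,
    heightOne_zero_succ]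

end Series

/-! ### Matching the two lattice sums with the two sums of zeta values -/

section Expansion

open PowerSeries

theorem hasSum_coeff_sum {ι : Type*} {s : Finset ι} {f : ι → PowerSeries ℝ} {x : ι → ℝ}
    (h : ∀ i ∈ s, HasSum (fun n => coeff n (f i)) (x i)) :
    HasSum (fun n => coeff n (∑ i ∈ s, f i)) (∑ i ∈ s, x i) := by
  simpa only [map_sum] using hasSum_sum h

theorem hasSum_coeff_smul {f : PowerSeries ℝ} {x : ℝ} (c : ℝ)
    (h : HasSum (fun n => coeff n f) x) : HasSum (fun n => coeff n (c • f)) (c * x) := by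
  simpa only [map_smul, smul_eq_mul] using h.mul_left c

theorem hasSum_coeff_multiPolylog_ofFn {q : ℕ} {γ : Fin (q + 1) → ℕ} (d : ℕ) (h0 : 2 ≤ γ 0)
    (h : ∀ i, 1 ≤ γ i) :
    HasSum (fun n => coeff n (multiPolylog (List.ofFn γ ++ List.replicate d 1)))
      (mzv (List.ofFn γ ++ List.replicate d 1)) := by
  rw [List.ofFn_succ, List.cons_append]
  refine hasSum_coeff_multiPolylog h0 fun b hb => ?_
  rw [List.mem_append, List.mem_ofFn, List.mem_replicate] at hb
  rcases hb with ⟨i, rfl⟩ | ⟨-, rfl⟩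
  · exact h _
  · exact le_rfl

theorem latticeSum_shuffleConv_eq (m n j k : ℕ) :
    latticeSum (fun b => shuffleConv
        (fun t => (t + k).choose k • heightOne 0 (t + k + 1)) b j) (m + 1) n =
      ∑ n₁ ∈ Finset.range (n + 1), ∑ p ∈ Finset.HasAntidiagonal.antidiagonal j,
        ∑ α ∈ posTuples (p.1 + 1) (n - n₁ + p.1 + 1),
          (((m + n₁).choose m : ℝ) * ((p.2 + k).choose k : ℝ)) •
            multiPolylog (List.ofFn (α + Pi.single 0 (m + 1 + n₁)) ++
              List.replicate (p.2 + k) 1) := by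
  rw [latticeSum, Finset.Nat.sum_antidiagonal_eq_sum_range_succ_mk]
  refine Finset.sum_congr rfl fun n₁ _ => ?_
  rw [shuffleConv, map_sum, Finset.smul_sum]
  refine Finset.sum_congr rfl fun p _ => ?_
  rw [← Finset.smul_sum, sum_posTuples_multiPolylog (p := n - n₁) _ _ (by ring), map_nsmul,
    map_nsmul, ← Nat.cast_smul_eq_nsmul ℝ, ← Nat.cast_smul_eq_nsmul ℝ, smul_smul,
    Nat.multichoose_eq, show m + 1 + n₁ - 1 = m + n₁ by omega, Nat.choose_symm_add]

theorem latticeSum_sum_shufflePow_eq (m n j k : ℕ) :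
    latticeSum (fun b => ∑ p ∈ Finset.HasAntidiagonal.antidiagonal k,
        shufflePow intDivX intDivOneSub b (p.1 + 1)
          ((j + 1 + p.2).choose (j + 1) • heightOne 1 (j + 1 + p.2))) (n + 1) m =
      ∑ t ∈ Finset.range (k + 1), ∑ q ∈ Finset.HasAntidiagonal.antidiagonal m,
        ∑ β ∈ posTuples (k + 1 - t + 1) (q.2 + (k + 1) - t + 1),
          (((q.1 + n).choose n : ℝ) * ((j + 1 + t).choose (j + 1) : ℝ)) •
            multiPolylog (List.ofFn (β + Pi.single 0 (q.1 + (n + 1)) +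
              Pi.single (Fin.last (k + 1 - t)) 1) ++ List.replicate (j + t) 1) := by
  rw [latticeSum, Finset.sum_comm]
  refine Finset.sum_congr rfl fun q _ => ?_
  -- The swap makes `t` the number of right-factor `B`s after the cut.
  rw [← Finset.Nat.sum_antidiagonal_swap, Finset.Nat.sum_antidiagonal_eq_sum_range_succ_mk,
    map_sum, Finset.smul_sum]
  refine Finset.sum_congr rfl fun t ht => ?_
  have ht' : t ≤ k := Nat.lt_succ_iff.1 (Finset.mem_range.1 ht)
  rw [← Finset.smul_sum, sum_posTuples_multiPolylog_last (p := q.2) _ _ (by omega)]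
  simp only [Prod.swap]
  rw [map_nsmul, map_nsmul, ← Nat.cast_smul_eq_nsmul ℝ, ← Nat.cast_smul_eq_nsmul ℝ, smul_smul,
    Nat.multichoose_eq, show n + 1 + q.1 - 1 = q.1 + n by omega, ← Nat.choose_symm_add,
    show k - t + 1 = k + 1 - t by omega, show n + 1 + q.1 = q.1 + (n + 1) by ring,
    show j + 1 + t = j + t + 1 by ring]

end Expansion

theorem theorem1p1 (m n j k : ℕ) (hm : 1 ≤ m) (hn : 1 ≤ n) (hj : 1 ≤ j) (hk : 1 ≤ k) :
    mzv ((m + 1) :: List.replicate (j - 1) 1) * mzv ((n + 1) :: List.replicate (k - 1) 1) =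
      (∑ n₁ ∈ Finset.range (n + 1), ∑ p ∈ Finset.HasAntidiagonal.antidiagonal j,
        ∑ α ∈ posTuples (p.1 + 1) (n - n₁ + p.1 + 1),
          ((m - 1 + n₁).choose (m - 1) : ℝ) * ((p.2 + k - 1).choose (k - 1) : ℝ) *
            mzv (List.ofFn (α + Pi.single 0 (m + n₁)) ++ List.replicate (p.2 + k - 1) 1)) +
      ∑ t ∈ Finset.range k, ∑ q ∈ Finset.HasAntidiagonal.antidiagonal (m - 1),
        ∑ β ∈ posTuples (k - t + 1) (q.2 + k - t + 1),
          ((q.1 + n - 1).choose (n - 1) : ℝ) * ((j + t).choose j : ℝ) *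
            mzv (List.ofFn (β + Pi.single 0 (q.1 + n) + Pi.single (Fin.last (k - t)) 1) ++
              List.replicate (j + t - 1) 1) := by
  obtain ⟨m, rfl⟩ := Nat.exists_eq_add_of_le' hm
  obtain ⟨n, rfl⟩ := Nat.exists_eq_add_of_le' hn
  obtain ⟨j, rfl⟩ := Nat.exists_eq_add_of_le' hj
  obtain ⟨k, rfl⟩ := Nat.exists_eq_add_of_le' hk
  have hone : ∀ d, ∀ b ∈ List.replicate d 1, 1 ≤ b := fun d b hb =>
    (List.eq_of_mem_replicate hb).ge
  have hL := hasSum_coeff_mul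
    (hasSum_coeff_multiPolylog (a := m + 1 + 1) (by omega) (hone j))
    (hasSum_coeff_multiPolylog (a := n + 1 + 1) (by omega) (hone k))
    (coeff_multiPolylog_nonneg _) (coeff_multiPolylog_nonneg _)
  rw [multiPolylog_cons_replicate_one, multiPolylog_cons_replicate_one,
    heightOne_succ_mul_heightOne, latticeSum_shuffleConv_eq, latticeSum_sum_shufflePow_eq] at hL
  -- It remains to sum the coefficients of the expansion term by term.
  refine hL.unique ?_
  simp only [map_add]
  simp only [← add_assoc, Nat.add_sub_cancel, Nat.add_right_comm _ 1]
  refine HasSum.add ?_ ?_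
  · refine hasSum_coeff_sum fun n₁ _ => hasSum_coeff_sum fun p _ => hasSum_coeff_sum fun α hα =>
      hasSum_coeff_smul _ (hasSum_coeff_multiPolylog_ofFn _ ?_ fun i => ?_)
    · have := (mem_posTuples.1 hα).2 0
      simp only [Pi.add_apply, Pi.single_eq_same]
      omega
    · have := (mem_posTuples.1 hα).2 i
      simp only [Pi.add_apply]
      omega
  · refine hasSum_coeff_sum fun t _ => hasSum_coeff_sum fun q _ => hasSum_coeff_sum fun β hβ =>
      hasSum_coeff_smul _ (hasSum_coeff_multiPolylog_ofFn _ ?_ fun i => ?_)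
    · have := (mem_posTuples.1 hβ).2 0
      simp only [Pi.add_apply, Pi.single_eq_same]
      omega
    · have := (mem_posTuples.1 hβ).2 i
      simp only [Pi.add_apply]
      omega
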